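/- Let $\mathbb F$ be a field of characteristic $p\ge 0$, let $n\ge 1$, and let $U_1,\dots,U_n$ be finite sets with $|U_a|>1$ for all $a$. Let $\mathfrak S$ be the factorial scheme of $U_1,\dots,U_n$, i.e. the direct product of the trivial association schemes on the $U_a$: its point set is $X=\prod_a U_a$, its relations are labelled by $E=\{0,1\}^n$, and $(\mathbf y,\mathbf z)\in R_{\mathbf g}$ iff, for every $a$, $\mathbf y_a\ne \mathbf z_a\Leftrightarrow \mathbf g_a=1$. Identify $\mathbf g\in E$ with its support $\{a:\mathbf g_a=1\}\subseteq\{1,\dots,n\}$, so that $\cap,\cup,\setminus,\triangle,\subseteq$ apply to elements of $E$; write $\mathbf 1$ for the all-one tuple, and for $V\subseteq\{1,\dots,n\}$ put $V^\circ=\{a\in V:|U_a|>2\}$. Let $k_{\mathbf g}=\prod_{a\in\mathbf g}(|U_a|-1)$ be the valency of $R_{\mathbf g}$. Fix $\mathbf x\in X$. For $\mathbf g\in E$ let $A_{\mathbf g}$ be the adjacency matrix of $R_{\mathbf g}$ over $\mathbb F$, let $E^*_{\mathbf g}$ be the diagonal $\{0,1\}$-matrix with $(\mathbf y,\mathbf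 y)$-entry $1$ iff $(\mathbf x,\mathbf y)\in R_{\mathbf g}$, and let $\mathbb T$ be the subalgebra of $M_X(\mathbb F)$ generated by all $A_{\mathbf g}$ and $E^*_{\mathbf g}$ (the Terwilliger $\mathbb F$-algebra of $\mathfrak S$ with respect to $\mathbf x$). Let $\mathrm{Rad}(\mathbb T)$ be its Jacobson radical. For $\mathbf g,\mathbf i\in E$ let $\mathbb P_{\mathbf g,\mathbf i}=\{\mathbf h\in E:\ \mathbf g\triangle\mathbf i\subseteq\mathbf h\subseteq(\mathbf g\triangle\mathbf i)\cup(\mathbf g\cap\mathbf i)^\circ\}$. For $\mathbf g,\mathbf h,\mathbf i,\mathbf j,\mathbf k\in E$ let $$[\mathbf g,\mathbf h,\mathbf i,\mathbf j,\mathbf k]=(\mathbf g\triangle\mathbf k)\cup\big((\mathbf g\cap\mathbf k)^\circ\setminus\mathbf i\big)\cup\big((\mathbf h\cup\mathbf j)\cap(\mathbf g\cap\mathbf i\cap\mathbf k)^\circ\big),\qquad \mathbf g\mathbf i=[\mathbf g,\mathbf 1,\mathbf 1,\mathbf 1,\mathbf i]=(\mathbf g\triangle\mathbf i)\cup(\mathbf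 g\cap\mathbf i)^\circ .$$ For $\mathbf h\in\mathbb P_{\mathbf g,\mathbf i}$ let $B_{\mathbf g,\mathbf h,\mathbf i}=\sum_{\mathbf g\triangle\mathbf i\subseteq\mathbf j\subseteq\mathbf h}E^*_{\mathbf g}A_{\mathbf j}E^*_{\mathbf i}$, and if moreover $p\nmid k_{\mathbf h}$ let $$D_{\mathbf g,\mathbf h,\mathbf i}=\sum_{\mathbf h\subseteq\mathbf l\subseteq\mathbf g\mathbf i,\ p\,\nmid\, k_{\mathbf l}}(-1)^{|\mathbf l\setminus\mathbf h|}\,k_{\mathbf i\cap\mathbf l}^{-1}\,B_{\mathbf g,\mathbf l,\mathbf i}\in\mathbb T .$$ **Theorem.** The cosets $D_{\mathbf a,\mathbf b,\mathbf c}+\mathrm{Rad}(\mathbb T)$, indexed by the triples $(\mathbf a,\mathbf b,\mathbf c)\in E^3$ with $\mathbf b\in\mathbb P_{\mathbf a,\mathbf c}$ and $p\nmid k_{\mathbf b}$, form an $\mathbb F$-basis of $\mathbb T/\mathrm{Rad}(\mathbb T)$. Let $\mathbf g,\mathbf h,\mathbf i,\mathbf j,\mathbf k,\mathbf l,\mathbf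 m,\mathbf q,\mathbf r\in E$ with $\mathbf h\in\mathbb P_{\mathbf g,\mathbf i}$, $\mathbf k\in\mathbb P_{\mathbf j,\mathbf l}$, $\mathbf q\in\mathbb P_{\mathbf m,\mathbf r}$ and $p\nmid k_{\mathbf h}k_{\mathbf k}k_{\mathbf q}$. If $\mathbf i=\mathbf j$ and $(\mathbf h\cap\mathbf i\cap\mathbf l)^\circ\subseteq\mathbf k$, then $[\mathbf g,\mathbf h,\mathbf i,\mathbf k,\mathbf l]\in\mathbb P_{\mathbf g,\mathbf l}$ and $p\nmid k_{[\mathbf g,\mathbf h,\mathbf i,\mathbf k,\mathbf l]}$. Moreover, the coefficient of the basis element $D_{\mathbf m,\mathbf q,\mathbf r}+\mathrm{Rad}(\mathbb T)$ in the product $(D_{\mathbf g,\mathbf h,\mathbf i}+\mathrm{Rad}(\mathbb T))(D_{\mathbf j,\mathbf k,\mathbf l}+\mathrm{Rad}(\mathbb T))$ is $$\delta_{\mathbf i,\mathbf j}\,\delta_{\mathbf m,\mathbf g}\,\delta_{\mathbf q,[\mathbf g,\mathbf h,\mathbf i,\mathbf k,\mathbf l]}\,\delta_{\mathbf r,\mathbf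 l}\,\delta_{(\mathbf g\cap\mathbf i)^\circ\setminus\mathbf h,\ (\mathbf i\cap\mathbf l)^\circ\setminus\mathbf k}\in\mathbb F .$$ In particular, all structure constants of this basis lie in $\{0,1\}\subseteq\mathbb F$. -/

import Mathlib

universe u v w

open Module

/-- An association scheme on a finite set `X` with relations labelled by `E`. The partition
`{R_e : e ∈ E}` of `X × X` is given by its labelling map: `(x, y) ∈ R_e` iff `rel x y = e`. -/
structure AssocScheme (X : Type u) (E : Type v) [Fintype X] [DecidableEq E] where
  /-- the label of the relation containing `(x, y)` -/
  rel : X → X → E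
  /-- every relation is nonempty -/
  rel_surj : ∀ e, ∃ x y, rel x y = e
  /-- the label of the diagonal relation -/
  zero : E
  rel_eq_zero : ∀ x y, rel x y = zero ↔ x = y
  /-- `R_{star e}` is the converse of `R_e` -/
  star : E → E
  star_rel : ∀ x y, star (rel x y) = rel y x
  /-- the intersection numbers: `inter g h i` is the number usually written `p_{g,h}^i` -/
  inter : E → E → E → ℕ
  card_eq_inter : ∀ g h x y,
    (Finset.univ.filter fun a => rel x a = g ∧ rel a y = h).card = inter g h (rel x y)

namespace AssocScheme

section General

variable {X : Type u} {E : Type v} [Fintype X] [DecidableEq X] [DecidableEq E]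

/-- The valency `k_g = p_{g,g*}^0`. -/
def valency (S : AssocScheme X E) (g : E) : ℕ := S.inter g (S.star g) S.zero

variable (F : Type w) [Field F]

/-- The adjacency matrix of `R_g` over `F`. -/
def adj (S : AssocScheme X E) (g : E) : Matrix X X F :=
  Matrix.of fun y z => if S.rel y z = g then 1 else 0

/-- The dual idempotent `E_g^*(x)` over `F`. -/
def dualIdem (S : AssocScheme X E) (x : X) (g : E) : Matrix X X F :=
  Matrix.diagonal fun y => if S.rel x y = g then 1 else 0

/-- The Terwilliger `F`-algebra of the scheme with respect to `x`. -/
def terwilliger (S : AssocScheme X E) (x : X) : Subalgebra F (Matrix X X F) :=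
  Algebra.adjoin F (Set.range (S.adj F) ∪ Set.range (S.dualIdem F x))

/-- The adjacency matrix as an element of the Terwilliger algebra. -/
def adjT (S : AssocScheme X E) (x : X) (g : E) : S.terwilliger F x :=
  ⟨S.adj F g, Algebra.subset_adjoin (Or.inl ⟨g, rfl⟩)⟩

/-- The dual idempotent as an element of the Terwilliger algebra. -/
def dualT (S : AssocScheme X E) (x : X) (g : E) : S.terwilliger F x :=
  ⟨S.dualIdem F x g, Algebra.subset_adjoin (Or.inr ⟨g, rfl⟩)⟩

end General

/-- The trivial scheme on a finite set with more than one element: `R_0` is the diagonal and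
`R_1` its complement. -/
def trivial (U : Type u) [Fintype U] [DecidableEq U] [Nontrivial U] :
    AssocScheme U (Fin 2) where
  rel x y := if x = y then 0 else 1
  rel_surj e := by
    obtain ⟨x, y, hxy⟩ := exists_pair_ne U
    fin_cases e
    · exact ⟨x, x, by simp⟩
    · exact ⟨x, y, by simp [hxy]⟩
  zero := 0
  rel_eq_zero x y := by by_cases h : x = y <;> simp [h]
  star := id
  star_rel x y := by simp [eq_comm]
  inter g h i :=
    if g = 0 then (if h = i then 1 else 0)
    else if h = 0 then (if i = 1 then 1 else 0)
    else if i = 0 then Fintype.card U - 1 else Fintype.card U - 2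
  card_eq_inter g h x y := by
    have e0 : ∀ a b : U, (if a = b then (0 : Fin 2) else 1) = 0 ↔ a = b := by
      intro a b; by_cases hab : a = b <;> simp [hab]
    have e1 : ∀ a b : U, (if a = b then (0 : Fin 2) else 1) = 1 ↔ a ≠ b := by
      intro a b; by_cases hab : a = b <;> simp [hab]
    have hs : ∀ a b : U, (Finset.univ.filter fun c : U => c ≠ a ∧ c ≠ b)
        = Finset.univ \ {a, b} := by
      intro a b; ext c; simp
    have hc : ∀ z : Fin 2, z = 0 ∨ z = 1 := by decide
    rcases hc g with rfl | rfl
    · have : (Finset.univ.filter fun a : U => (if x = a then (0 : Fin 2) else 1) = 0 ∧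
          (if a = y then (0 : Fin 2) else 1) = h)
          = if h = (if x = y then (0 : Fin 2) else 1) then {x} else ∅ := by
        ext a
        rw [Finset.mem_filter, e0]
        by_cases hxa : x = a
        · subst hxa
          by_cases h1 : h = (if x = y then (0 : Fin 2) else 1)
          · rw [if_pos h1]; simp [h1]
          · rw [if_neg h1]; simpa using Ne.symm h1
        · by_cases h1 : h = (if x = y then (0 : Fin 2) else 1)
          · rw [if_pos h1]; simp [hxa, Ne.symm hxa]
          · rw [if_neg h1]; simp [hxa]
      rw [this]
      by_cases h1 : h = (if x = y then (0 : Fin 2) else 1)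
      · rw [if_pos h1, if_pos rfl, if_pos h1]; simp
      · rw [if_neg h1, if_pos rfl, if_neg h1]; simp
    · rcases hc h with rfl | rfl
      · have : (Finset.univ.filter fun a : U => (if x = a then (0 : Fin 2) else 1) = 1 ∧
            (if a = y then (0 : Fin 2) else 1) = 0) = if x = y then ∅ else {y} := by
          ext a
          rw [Finset.mem_filter, e0, e1]
          split_ifs with h1
          · subst h1; simp [eq_comm]
          · simp only [Finset.mem_univ, true_and, Finset.mem_singleton]
            constructor
            · exact fun h2 => h2.2
            · rintro rfl; exact ⟨h1, rfl⟩
        rw [this]; by_cases hxy : x = y <;> simp [hxy]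
      · have : (Finset.univ.filter fun a : U => (if x = a then (0 : Fin 2) else 1) = 1 ∧
            (if a = y then (0 : Fin 2) else 1) = 1) = Finset.univ \ {x, y} := by
          rw [← hs]
          ext a
          simp only [Finset.mem_filter, e1, ne_comm]
        rw [this, Finset.card_sdiff_of_subset (Finset.subset_univ _), Finset.card_univ]
        by_cases hxy : x = y
        · simp [hxy]
        · rw [Finset.card_pair hxy]; simp [hxy]

/-- The direct product of finitely many association schemes. -/
def pi {ι : Type w} [Fintype ι] [DecidableEq ι] {X : ι → Type u} {E : ι → Type v}
    [∀ a, Fintype (X a)] [∀ a, DecidableEq (E a)]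
    (S : ∀ a, AssocScheme (X a) (E a)) : AssocScheme (∀ a, X a) (∀ a, E a) where
  rel x y := fun a => (S a).rel (x a) (y a)
  rel_surj e := by
    choose x y h using fun a => (S a).rel_surj (e a)
    exact ⟨x, y, funext h⟩
  zero := fun a => (S a).zero
  rel_eq_zero x y := by simp [funext_iff, rel_eq_zero]
  star e := fun a => (S a).star (e a)
  star_rel x y := by simp [star_rel]
  inter g h i := ∏ a, (S a).inter (g a) (h a) (i a)
  card_eq_inter g h x y := by
    simp only [← card_eq_inter]
    rw [← Fintype.card_piFinset]
    congr 1
    ext a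
    simp [funext_iff, forall_and]

end AssocScheme

namespace FactorialScheme

/-- The `n`-tuples with entries in `{0, 1}`. -/
abbrev Tup (n : ℕ) := Fin n → Fin 2

/-- The support of a tuple: the positions of its ones. -/
def supp {n : ℕ} (g : Tup n) : Finset (Fin n) := Finset.univ.filter fun a => g a = 1

/-- The tuple with a given support. -/
def ofSupp {n : ℕ} (V : Finset (Fin n)) : Tup n := fun a => if a ∈ V then 1 else 0

/-- The Kronecker delta with values in `F`. -/
def kdelta (F : Type w) [Field F] {α : Type*} [DecidableEq α] (a b : α) : F :=
  if a = b then 1 else 0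

section Combinatorics

variable {n : ℕ} (U : Fin n → Type u) [∀ a, Fintype (U a)]

/-- `V° = {a ∈ V : |U_a| > 2}`. -/
def circ (V : Finset (Fin n)) : Finset (Fin n) := V.filter fun a => 2 < Fintype.card (U a)

/-- `PP U g i` is the set `P_{g,i}` of all `h` with
`g △ i ⊆ h ⊆ (g △ i) ∪ (g ∩ i)°` (on supports). -/
def PP (g i : Tup n) : Finset (Tup n) :=
  Finset.univ.filter fun h => symmDiff (supp g) (supp i) ⊆ supp h ∧
    supp h ⊆ symmDiff (supp g) (supp i) ∪ circ U (supp g ∩ supp i)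

/-- The tuple `[g, h, i, j, k]`. -/
def bracket (g h i j k : Tup n) : Tup n :=
  ofSupp (symmDiff (supp g) (supp k) ∪ (circ U (supp g ∩ supp k) \ supp i) ∪
    ((supp h ∪ supp j) ∩ circ U (supp g ∩ supp i ∩ supp k)))

/-- The tuple `gh = [g, 1, 1, 1, h]`. -/
def prodTup (g h : Tup n) : Tup n := bracket U g 1 1 1 h

variable [∀ a, DecidableEq (U a)] [∀ a, Nontrivial (U a)]

/-- The factorial scheme: the direct product of the trivial schemes on `U_1, …, U_n`. -/
def scheme : AssocScheme (∀ a, U a) (Tup n) :=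
  AssocScheme.pi fun a => AssocScheme.trivial (U a)

/-- The valency `k_g` in the factorial scheme. -/
def val (g : Tup n) : ℕ := (scheme U).valency g

end Combinatorics

section Algebra

variable (F : Type w) [Field F] {n : ℕ} (U : Fin n → Type u) [∀ a, Fintype (U a)]
  [∀ a, DecidableEq (U a)] [∀ a, Nontrivial (U a)] (x : ∀ a, U a)

/-- The Terwilliger `F`-algebra `T` of the factorial scheme with respect to `x`. -/
abbrev T : Type _ := (scheme U).terwilliger F x

/-- The Jacobson radical of `T`. -/
abbrev RadT : Ideal (T F U x) := Ring.jacobson (T F U x)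

/-- `B_{g,h,i} = ∑_j E_g^* A_j E_i^*` over all `j` with `g △ i ⊆ j ⊆ h` (on supports). -/
def B (g h i : Tup n) : T F U x :=
  ∑ j ∈ Finset.univ.filter
      (fun j : Tup n => symmDiff (supp g) (supp i) ⊆ supp j ∧ supp j ⊆ supp h),
    (scheme U).dualT F x g * (scheme U).adjT F x j * (scheme U).dualT F x i

/-- `D_{g,h,i} = ∑_l (-1)^{|l ∖ h|} k_{i ∩ l}⁻¹ B_{g,l,i}` over all `l` with `h ⊆ l ⊆ gi` (on
supports) and `p ∤ k_l`; collecting the terms with `|l ∖ h| = k` gives the usual double sum.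
It is used for `h ∈ P_{g,i}` with `p ∤ k_h`. -/
def D (p : ℕ) (g h i : Tup n) : T F U x :=
  ∑ l ∈ Finset.univ.filter
      (fun l : Tup n => supp h ⊆ supp l ∧ supp l ⊆ supp (prodTup U g i) ∧ ¬ p ∣ val U l),
    ((-1 : F) ^ (supp l \ supp h).card *
      ((val U (ofSupp (supp i ∩ supp l)) : ℕ) : F)⁻¹) • B F U x g l i

/-- The coset `D_{g,h,i} + Rad(T)`. -/
def Dbar (p : ℕ) (g h i : Tup n) : T F U x ⧸ RadT F U x :=
  Ideal.Quotient.mk (RadT F U x) (D F U x p g h i)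

/-- The index set of all triples `(a, b, c)` with `b ∈ P_{a,c}` and `p ∤ k_b`. -/
abbrev Idx (p : ℕ) : Type :=
  {t : Tup n × Tup n × Tup n // t.2.1 ∈ PP U t.1 t.2.2 ∧ ¬ p ∣ val U t.2.1}

end Algebra

end FactorialScheme

open FactorialScheme

/-!
Everything factors over the coordinates. A matrix indexed by `X = ∏ a, U a` that is a Kronecker
product (`tensor`) of matrices indexed by the `U a` is multiplied factor by factor; the adjacency
matrices and the dual idempotents of the factorial scheme are such products, and so are the
elements `B_{g,h,i}` and, by distributivity, the `D_{g,h,i}` (`coe_D`). The algebra `T` is spanned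
by Kronecker products of elements of the Terwilliger algebras of the trivial schemes
(`mem_span_tensor`, `tensor_mem`), so the theorem comes down to one trivial scheme.

Let `k` be the valency of the relation `R_1` of a trivial scheme. Its Terwilliger algebra is spanned
by the `E_g^*` and the blocks `E_g^* J E_i^*`; blocks multiply like matrix units up to valencies.
If `k` is invertible in `F`, the factors `k_i⁻¹ E_g^* J E_i^*` are matrix units of a full `2 × 2`
matrix algebra, and `E_1^* - k⁻¹ E_1^* J E_1^*` is an idempotent orthogonal to them, nonzero iff the
underlying set has more than two points. If `k` vanishes in `F`, the blocks other than
`E_0^* J E_0^*` span a nilpotent ideal, complemented by the two idempotents `E_0^*` and `E_1^*`.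
Calling a coordinate exceptional (`IsExc`) when it lies in `(g ∩ i)° ∖ h`, that is, when the factor
is of the form `E_1^* - k⁻¹ E_1^* J E_1^*`, two factors have a nonzero product iff they are
composable and both or neither are exceptional (`factor_mul_factor`).

Hence the structure constants are already those of the `D_{g,h,i}` in `T`, before passing to the
quotient (`D_mul_D`). The `D_{g,h,i}` span `T` modulo the Kronecker products with a nilpotent
factor, which lie in the radical (`tensor_mem_radical`). They are independent modulo the radical
because flanking a combination by `D_{i,h,g}` isolates the coefficient of `D_{g,h,i}` (`D_mul_D_mul_D`),
while the von Neumann regular element `D_{i,h,g} ≠ 0` is not in the radical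
(`eq_zero_of_mem_jacobson`).
-/

namespace FactorialScheme

/-! ### Kronecker products of families of matrices -/

section Tensor

variable {F : Type w} [Field F] {ι : Type*} [Fintype ι] {U : ι → Type u}

/-- The Kronecker product of a finite family of square matrices, as a matrix indexed by the
product of the index sets, multilinear in the family. -/
def tensor : MultilinearMap F (fun a => Matrix (U a) (U a) F)
    (Matrix (∀ a, U a) (∀ a, U a) F) where
  toFun M := Matrix.of fun y z => ∏ a, M a (y a) (z a)
  map_update_add' M a P Q := by
    ext y z
    exact ((MultilinearMap.mkPiAlgebra F ι F).compLinearMap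
      fun b => Matrix.entryLinearMap F F (y b) (z b)).map_update_add M a P Q
  map_update_smul' M a c P := by
    ext y z
    exact ((MultilinearMap.mkPiAlgebra F ι F).compLinearMap
      fun b => Matrix.entryLinearMap F F (y b) (z b)).map_update_smul M a c P

theorem tensor_apply (M : ∀ a, Matrix (U a) (U a) F) (y z : ∀ a, U a) :
    tensor M y z = ∏ a, M a (y a) (z a) := rfl

theorem tensor_mul [DecidableEq ι] [∀ a, Fintype (U a)] (M N : ∀ a, Matrix (U a) (U a) F) :
    tensor M * tensor N = tensor fun a => M a * N a := by
  ext y z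
  simp only [Matrix.mul_apply, tensor_apply, Finset.prod_univ_sum, Fintype.piFinset_univ,
    Finset.prod_mul_distrib]

theorem tensor_one [DecidableEq ι] [∀ a, DecidableEq (U a)] :
    tensor (fun a => (1 : Matrix (U a) (U a) F)) = 1 := by
  ext y z
  simp only [tensor_apply, Matrix.one_apply, Finset.prod_ite_zero, Finset.prod_const_one,
    Finset.mem_univ, true_implies, funext_iff]

theorem tensor_eq_zero {M : ∀ a, Matrix (U a) (U a) F} (a : ι) (h : M a = 0) : tensor M = 0 :=
  tensor.map_coord_zero a h

theorem tensor_ne_zero {M : ∀ a, Matrix (U a) (U a) F} (h : ∀ a, M a ≠ 0) : tensor M ≠ 0 := by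
  have key : ∀ a, ∃ y z, M a y z ≠ 0 := by
    intro a
    by_contra! hz
    exact h a (Matrix.ext hz)
  choose y z hyz using key
  intro h0
  exact Finset.prod_ne_zero_iff.2 (fun a _ => hyz a) (congrFun (congrFun h0 y) z)

end Tensor

/-! ### Blocks of the all-one matrix of an association scheme -/

section Scheme

variable {X : Type u} {E : Type v} [Fintype X] [DecidableEq E] (F : Type w) [Field F]

theorem card_rel_eq (S : AssocScheme X E) (x : X) (g : E) :
    (Finset.univ.filter fun y => S.rel x y = g).card = S.valency g := by
  have h := S.card_eq_inter g (S.star g) x x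
  rw [(S.rel_eq_zero x x).2 rfl] at h
  rw [AssocScheme.valency, ← h]
  congr 1
  ext y
  simp only [Finset.mem_filter, Finset.mem_univ, true_and, iff_self_and]
  rintro rfl
  exact (S.star_rel x y).symm

/-- The characteristic vector of the set of all points in relation `g` to `x`. -/
def sphere (S : AssocScheme X E) (x : X) (g : E) : X → F :=
  fun y => if S.rel x y = g then 1 else 0

/-- The block `E_g^* J E_i^*` of the all-one matrix `J`. -/
def block (S : AssocScheme X E) (x : X) (g i : E) : Matrix X X F :=
  Matrix.vecMulVec (sphere F S x g) (sphere F S x i)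

variable (S : AssocScheme X E) (x : X)

theorem block_apply (g i : E) (y z : X) :
    block F S x g i y z = if S.rel x y = g ∧ S.rel x z = i then 1 else 0 := by
  simp only [block, Matrix.vecMulVec_apply, sphere]
  split_ifs <;> simp_all

theorem block_mul_block (g i j l : E) :
    block F S x g i * block F S x j l =
      if i = j then (S.valency i : F) • block F S x g l else 0 := by
  have : sphere F S x i ⬝ᵥ sphere F S x j = if i = j then (S.valency i : F) else 0 := by
    rw [← card_rel_eq S x]
    split_ifs with h
    · subst h
      simp [dotProduct, sphere, ← ite_and]
    · refine Finset.sum_eq_zero fun y _ => ?_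
      simp only [sphere]
      split_ifs <;> simp_all
  rw [block, block, Matrix.vecMulVec_mul_vecMulVec, this]
  split_ifs
  · rw [Matrix.vecMulVec_smul]; rfl
  · simp

variable [DecidableEq X]

theorem dual_mul_block (g i l : E) :
    S.dualIdem F x g * block F S x i l = if g = i then block F S x i l else 0 := by
  ext y z
  rw [AssocScheme.dualIdem, Matrix.diagonal_mul, block_apply]
  split_ifs with h1 h2 h3 h4 <;> simp_all [block_apply]

theorem block_mul_dual (g i l : E) :
    block F S x g i * S.dualIdem F x l = if i = l then block F S x g i else 0 := by
  ext y z
  rw [AssocScheme.dualIdem, Matrix.mul_diagonal, block_apply]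
  split_ifs with h1 h2 h3 h4 <;> simp_all [block_apply]

theorem dual_mul_dual (g i : E) :
    S.dualIdem F x g * S.dualIdem F x i = if g = i then S.dualIdem F x g else 0 := by
  rw [AssocScheme.dualIdem, AssocScheme.dualIdem, Matrix.diagonal_mul_diagonal]
  ext y z
  rcases eq_or_ne y z with rfl | h
  · by_cases hg : S.rel x y = g
    · subst hg
      split_ifs <;> simp_all
    · split_ifs <;> simp [hg]
  · split_ifs <;> simp [h]

end Scheme

/-! ### The coordinates of an admissible triple, and the factors over a trivial scheme -/

section Exceptional

variable (V : Type u) [Fintype V]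

/-- The condition on one coordinate `(g, h, i)` of a triple to lie in `(g ∩ i)° ∖ h`. -/
def IsExc (g h i : Fin 2) : Prop := (g = 1 ∧ i = 1 ∧ 2 < Fintype.card V) ∧ h = 0

instance (g h i : Fin 2) : Decidable (IsExc V g h i) := by unfold IsExc; infer_instance

variable {V} in
theorem isExc_symm {g h i : Fin 2} : IsExc V g h i ↔ IsExc V i h g := by
  unfold IsExc; tauto

end Exceptional

section Local

variable (F : Type w) [Field F] (V : Type u) [Fintype V] [DecidableEq V] [Nontrivial V]

@[simp] theorem valency_trivial_zero : (AssocScheme.trivial V).valency 0 = 1 := by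
  simp [AssocScheme.valency, AssocScheme.trivial]

theorem valency_trivial_one : (AssocScheme.trivial V).valency 1 = Fintype.card V - 1 := by
  simp [AssocScheme.valency, AssocScheme.trivial]

theorem fin_two_eq (g : Fin 2) : g = 0 ∨ g = 1 := by omega

/-- The condition on one coordinate `(g, h, i)` of a triple to index a basis element: `h` lies in
`P_{g,i}`, and its valency is nonzero in `F`. -/
structure Adm (g h i : Fin 2) : Prop where
  lower : g ≠ i → h = 1
  upper : h = 1 → g ≠ i ∨ (g = 1 ∧ i = 1 ∧ 2 < Fintype.card V)
  val_ne : ((AssocScheme.trivial V).valency h : F) ≠ 0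

/-- One coordinate of the tuple `[g, h, i, k, l]`. -/
def bracketCoord (g h i k l : Fin 2) : Fin 2 :=
  if g ≠ l ∨ (g = 1 ∧ l = 1 ∧ 2 < Fintype.card V) ∧ (i = 0 ∨ h = 1 ∨ k = 1) then 1 else 0

variable (x : V)

/-- The Kronecker factor of `D_{g,h,i}` at one coordinate: a rescaled block of the all-one matrix,
or `E_1^* - k_1⁻¹ E_1^* J E_1^*`, where `k_1⁻¹ = 0` if `k_1` vanishes in `F`. -/
def factor (g h i : Fin 2) : Matrix V V F :=
  if IsExc V g h i then
    (AssocScheme.trivial V).dualIdem F x 1 -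
      ((AssocScheme.trivial V).valency 1 : F)⁻¹ • block F (AssocScheme.trivial V) x 1 1
  else ((AssocScheme.trivial V).valency i : F)⁻¹ • block F (AssocScheme.trivial V) x g i

variable {V}

theorem trivial_rel (y z : V) : (AssocScheme.trivial V).rel y z = if y = z then 0 else 1 := rfl

theorem dual_trivial_zero :
    (AssocScheme.trivial V).dualIdem F x 0 = block F (AssocScheme.trivial V) x 0 0 := by
  ext y z
  simp only [AssocScheme.dualIdem, block_apply, Matrix.diagonal_apply, trivial_rel]
  split_ifs <;> simp_all

/-- On a set of two points the sphere of `x` is a single point, so its block is the dual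
idempotent. -/
theorem dual_trivial_one (h : ¬ 2 < Fintype.card V) :
    (AssocScheme.trivial V).dualIdem F x 1 = block F (AssocScheme.trivial V) x 1 1 := by
  have key : ∀ y z : V, x ≠ y → x ≠ z → y = z := by
    intro y z hy hz
    by_contra hyz
    exact h (Fintype.two_lt_card_iff.2 ⟨x, y, z, hy, hz, hyz⟩)
  ext y z
  simp only [AssocScheme.dualIdem, block_apply, Matrix.diagonal_apply, trivial_rel]
  have := key y z
  split_ifs <;> simp_all

variable (V) in
theorem valency_one_of_card_le (h : ¬ 2 < Fintype.card V) :
    (AssocScheme.trivial V).valency 1 = 1 := by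
  have := Fintype.one_lt_card (α := V)
  rw [valency_trivial_one]
  omega

variable {F} {g h i j k l : Fin 2}

theorem Adm.symm (H : Adm F V g h i) : Adm F V i h g :=
  ⟨fun e => H.lower e.symm, fun e => (H.upper e).imp Ne.symm fun e => ⟨e.2.1, e.1, e.2.2⟩,
    H.val_ne⟩

theorem Adm.valency_ne_zero (H : Adm F V g h i) (hexc : ¬ IsExc V g h i) :
    ((AssocScheme.trivial V).valency g : F) ≠ 0 ∧ ((AssocScheme.trivial V).valency i : F) ≠ 0 := by
  obtain ⟨h1, h2, h3⟩ := H
  by_cases hc : 2 < Fintype.card V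
  · rcases fin_two_eq g with rfl | rfl <;> rcases fin_two_eq h with rfl | rfl <;>
      rcases fin_two_eq i with rfl | rfl <;> simp_all [IsExc]
  · have := valency_one_of_card_le V hc
    rcases fin_two_eq g with rfl | rfl <;> rcases fin_two_eq i with rfl | rfl <;>
      simp [this]

theorem Adm.bracketCoord (H : Adm F V g h i) (K : Adm F V i k l) :
    Adm F V g (bracketCoord V g h i k l) l := by
  obtain ⟨h1, h2, h3⟩ := H
  obtain ⟨k1, k2, k3⟩ := K
  refine ⟨?_, ?_, ?_⟩ <;> simp only [FactorialScheme.bracketCoord]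
  · intro e; simp [e]
  · split_ifs with c
    · tauto
    · simp
  · split_ifs with c
    · by_cases e : h = 1
      · exact e ▸ h3
      by_cases e' : k = 1
      · exact e' ▸ k3
      exfalso
      rcases fin_two_eq g with rfl | rfl <;> rcases fin_two_eq i with rfl | rfl <;>
        rcases fin_two_eq l with rfl | rfl <;> simp_all
    · simp

/-- If `k_1` vanishes in `F`, then so does the inverse, and the idempotent is `E_1^*`. -/
theorem exc_idem :
    let Q := (AssocScheme.trivial V).dualIdem F x 1 -
      ((AssocScheme.trivial V).valency 1 : F)⁻¹ • block F (AssocScheme.trivial V) x 1 1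
    Q * Q = Q := by
  intro Q
  simp only [Q, mul_sub, sub_mul, Matrix.smul_mul, Matrix.mul_smul, dual_mul_dual, dual_mul_block,
    block_mul_dual, block_mul_block, if_true, smul_smul]
  by_cases hk : ((AssocScheme.trivial V).valency 1 : F) = 0
  · simp [hk]
  · rw [inv_mul_cancel₀ hk, mul_one]
    abel

/-- Over a sphere of invertible valency the exceptional idempotent is orthogonal to all blocks. -/
theorem exc_mul_block (hi : ((AssocScheme.trivial V).valency i : F) ≠ 0) :
    ((AssocScheme.trivial V).dualIdem F x 1 -
      ((AssocScheme.trivial V).valency 1 : F)⁻¹ • block F (AssocScheme.trivial V) x 1 1) *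
      block F (AssocScheme.trivial V) x i l = 0 := by
  rcases fin_two_eq i with rfl | rfl
  · simp [sub_mul, dual_mul_block, block_mul_block]
  · simp [sub_mul, dual_mul_block, block_mul_block, smul_smul, inv_mul_cancel₀ hi]

theorem block_mul_exc (hi : ((AssocScheme.trivial V).valency i : F) ≠ 0) :
    block F (AssocScheme.trivial V) x l i *
      ((AssocScheme.trivial V).dualIdem F x 1 -
      ((AssocScheme.trivial V).valency 1 : F)⁻¹ • block F (AssocScheme.trivial V) x 1 1)
      = 0 := by
  rcases fin_two_eq i with rfl | rfl
  · simp [mul_sub, block_mul_dual, block_mul_block]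
  · simp [mul_sub, block_mul_dual, block_mul_block, smul_smul, inv_mul_cancel₀ hi]

theorem factor_mul_factor (H : Adm F V g h i) (K : Adm F V j k l) :
    factor F V x g h i * factor F V x j k l =
      if i = j ∧ (IsExc V g h i ↔ IsExc V j k l) then
        factor F V x g (bracketCoord V g h i k l) l else 0 := by
  by_cases e1 : IsExc V g h i <;> by_cases e2 : IsExc V j k l
  · have e3 : IsExc V g (bracketCoord V g h i k l) l := by
      obtain ⟨⟨rfl, rfl, hc⟩, rfl⟩ := e1
      obtain ⟨⟨rfl, rfl, hc⟩, rfl⟩ := e2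
      simp [IsExc, FactorialScheme.bracketCoord, hc]
    obtain rfl : i = j := e1.1.2.1.trans e2.1.1.symm
    rw [if_pos ⟨rfl, iff_of_true e1 e2⟩, factor, factor, factor, if_pos e1, if_pos e2, if_pos e3]
    exact exc_idem x
  · simp only [factor, if_pos e1, if_neg e2, Matrix.mul_smul,
      exc_mul_block x (K.valency_ne_zero e2).1, smul_zero]
    rw [if_neg (by tauto)]
  · simp only [factor, if_pos e2, if_neg e1, Matrix.smul_mul,
      block_mul_exc x (H.valency_ne_zero e1).2, smul_zero]
    rw [if_neg (by tauto)]
  · simp only [factor, if_neg e2, iff_of_false e1 e2, and_true, Matrix.smul_mul,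
      Matrix.mul_smul, block_mul_block]
    split_ifs with hij e3
    · exfalso
      subst hij
      obtain ⟨h1, h2, h3⟩ := H
      obtain ⟨k1, k2, k3⟩ := K
      obtain ⟨⟨rfl, rfl, hc⟩, e⟩ := e3
      rcases fin_two_eq h with rfl | rfl <;> rcases fin_two_eq i with rfl | rfl <;>
        rcases fin_two_eq k with rfl | rfl <;> simp_all [IsExc, FactorialScheme.bracketCoord]
    · rw [smul_smul, smul_smul, mul_comm (_ : F)⁻¹, mul_assoc, mul_comm, mul_assoc,
        mul_inv_cancel₀ (H.valency_ne_zero e1).2, mul_one]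
    · simp

/-- The middle entry of an admissible triple is determined by the outer two and by whether the
triple is exceptional. -/
theorem Adm.middle_eq (H : Adm F V g h i) (K : Adm F V g k i)
    (e : IsExc V g h i ↔ IsExc V g k i) : h = k := by
  obtain ⟨h1, h2, h3⟩ := H
  obtain ⟨k1, k2, k3⟩ := K
  rcases fin_two_eq g with rfl | rfl <;> rcases fin_two_eq i with rfl | rfl <;>
    rcases fin_two_eq h with rfl | rfl <;> rcases fin_two_eq k with rfl | rfl <;>
    simp_all [IsExc]

theorem factor_ne_zero (H : Adm F V g h i) : factor F V x g h i ≠ 0 := by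
  obtain ⟨y, hy⟩ := exists_ne x
  have hpt : ∀ g : Fin 2, ∃ y, (AssocScheme.trivial V).rel x y = g := by
    intro g
    rcases fin_two_eq g with rfl | rfl
    · exact ⟨x, by simp [trivial_rel]⟩
    · exact ⟨y, by simp [trivial_rel, hy.symm]⟩
  intro h0
  by_cases e : IsExc V g h i
  · rw [factor, if_pos e] at h0
    obtain ⟨a, b, ha, hb, hab⟩ : ∃ a b : V, x ≠ a ∧ x ≠ b ∧ a ≠ b := by
      have h2 : 1 < (Finset.univ.erase x).card := by
        rw [Finset.card_erase_of_mem (Finset.mem_univ x), Finset.card_univ]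
        have := e.1.2.2
        omega
      obtain ⟨a, ha, b, hb, hab⟩ := Finset.one_lt_card.1 h2
      exact ⟨a, b, (Finset.ne_of_mem_erase ha).symm, (Finset.ne_of_mem_erase hb).symm, hab⟩
    -- The entry at `(a, b)` forces `k_1⁻¹ = 0`, after which the entry at `(a, a)` is `1`.
    have hoff := congrFun (congrFun h0 a) b
    have hdiag := congrFun (congrFun h0 a) a
    simp only [Matrix.sub_apply, Matrix.smul_apply, block_apply, AssocScheme.dualIdem,
      Matrix.diagonal_apply, trivial_rel, if_neg ha, if_neg hb, if_neg hab, and_self,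
      if_true, smul_eq_mul, mul_one, Matrix.zero_apply, zero_sub, neg_eq_zero] at hoff hdiag
    rw [hoff] at hdiag
    simp at hdiag
  · rw [factor, if_neg e] at h0
    obtain ⟨a, ha⟩ := hpt g
    obtain ⟨b, hb⟩ := hpt i
    have hab := congrFun (congrFun h0 a) b
    simp only [Matrix.smul_apply, block_apply, ha, hb, and_self, if_true, smul_eq_mul, mul_one,
      Matrix.zero_apply, inv_eq_zero] at hab
    exact (H.valency_ne_zero e).2 hab

/-- The admissible factors behave like matrix units: flanking a factor by a factor of the
transposed triple picks out one coefficient. -/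
theorem factor_mul_factor_mul_factor (H : Adm F V g h i) (K : Adm F V j k l) :
    factor F V x i h g * factor F V x j k l * factor F V x i h g =
      if j = g ∧ k = h ∧ l = i then factor F V x i h g else 0 := by
  rw [factor_mul_factor x H.symm K]
  by_cases hc : j = g ∧ k = h ∧ l = i
  · obtain ⟨rfl, rfl, rfl⟩ := hc
    rw [if_pos ⟨rfl, isExc_symm⟩]
    have B := H.symm.bracketCoord K
    have hexc : IsExc V l (bracketCoord V l k j k l) l ↔ IsExc V l k j := by
      obtain ⟨h1, h2, h3⟩ := H
      rcases fin_two_eq k with rfl | rfl <;> rcases fin_two_eq j with rfl | rfl <;>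
        rcases fin_two_eq l with rfl | rfl <;>
        by_cases hc : 2 < Fintype.card V <;> simp_all [IsExc, FactorialScheme.bracketCoord]
    rw [factor_mul_factor x B H.symm, if_pos ⟨rfl, hexc⟩, if_pos ⟨rfl, rfl, rfl⟩]
    congr 1
    refine (B.bracketCoord H.symm).middle_eq H.symm ?_
    obtain ⟨h1, h2, h3⟩ := H
    rcases fin_two_eq k with rfl | rfl <;> rcases fin_two_eq j with rfl | rfl <;>
      rcases fin_two_eq l with rfl | rfl <;>
      by_cases hc : 2 < Fintype.card V <;> simp_all [IsExc, FactorialScheme.bracketCoord]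
  · rw [if_neg hc]
    split_ifs with h1
    · obtain ⟨rfl, h1⟩ := h1
      rw [factor_mul_factor x (H.symm.bracketCoord K) H.symm, if_neg]
      rintro ⟨rfl, -⟩
      exact hc ⟨rfl, K.middle_eq H (h1.symm.trans isExc_symm), rfl⟩
    · simp

end Local

/-! ### Supports, valencies and the index set in coordinates -/

section Support

variable {n : ℕ}

theorem mem_supp {g : Tup n} {a : Fin n} : a ∈ supp g ↔ g a = 1 := by simp [supp]

theorem mem_symmDiff_supp {g i : Tup n} {a : Fin n} :
    a ∈ symmDiff (supp g) (supp i) ↔ g a ≠ i a := by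
  rw [Finset.mem_symmDiff, mem_supp, mem_supp]
  rcases fin_two_eq (g a) with h | h <;> rcases fin_two_eq (i a) with h' | h' <;> simp [h, h']

variable (U : Fin n → Type u) [∀ a, Fintype (U a)]

theorem mem_circ {W : Finset (Fin n)} {a : Fin n} :
    a ∈ circ U W ↔ a ∈ W ∧ 2 < Fintype.card (U a) := by simp [circ]

theorem bracket_apply (g h i k l : Tup n) (a : Fin n) :
    bracket U g h i k l a = bracketCoord (U a) (g a) (h a) (i a) (k a) (l a) := by
  simp only [bracket, ofSupp, bracketCoord, Finset.mem_union, mem_symmDiff_supp, mem_circ,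
    Finset.mem_sdiff, Finset.mem_inter, mem_supp]
  congr 1
  rcases fin_two_eq (i a) with h' | h' <;> simp only [h'] <;> grind

theorem prodTup_apply_eq_one {g i : Tup n} {a : Fin n} : prodTup U g i a = 1 ↔
    g a ≠ i a ∨ (g a = 1 ∧ i a = 1 ∧ 2 < Fintype.card (U a)) := by
  rw [prodTup, bracket_apply]
  simp [bracketCoord]
  tauto

/-- The sets `(g ∩ i)° ∖ h` and `(i ∩ l)° ∖ k` agree iff their indicators agree coordinatewise. -/
theorem circ_sdiff_eq_iff {g h i j k l : Tup n} :
    circ U (supp g ∩ supp i) \ supp h = circ U (supp j ∩ supp l) \ supp k ↔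
      ∀ a, (IsExc (U a) (g a) (h a) (i a) ↔ IsExc (U a) (j a) (k a) (l a)) := by
  have key : ∀ (g h i : Tup n) (a : Fin n),
      a ∈ circ U (supp g ∩ supp i) \ supp h ↔ IsExc (U a) (g a) (h a) (i a) := by
    intro g h i a
    simp only [Finset.mem_sdiff, mem_circ, Finset.mem_inter, mem_supp, IsExc]
    rcases fin_two_eq (h a) with h' | h' <;> simp [h', and_assoc]
  simp only [Finset.ext_iff, key]

variable [∀ a, DecidableEq (U a)] [∀ a, Nontrivial (U a)]

theorem val_eq_prod (g : Tup n) :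
    val U g = ∏ a, (AssocScheme.trivial (U a)).valency (g a) := rfl

variable (F : Type w) [Field F] (p : ℕ) [CharP F p]

theorem not_dvd_val_iff (g : Tup n) :
    ¬ p ∣ val U g ↔ ∀ a, ((AssocScheme.trivial (U a)).valency (g a) : F) ≠ 0 := by
  rw [← CharP.cast_eq_zero_iff F p, val_eq_prod, Nat.cast_prod, Finset.prod_eq_zero_iff]
  simp

/-- The index set of the basis is a product over the coordinates. -/
theorem mem_PP_and_not_dvd_iff (g h i : Tup n) :
    (h ∈ PP U g i ∧ ¬ p ∣ val U h) ↔ ∀ a, Adm F (U a) (g a) (h a) (i a) := by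
  rw [not_dvd_val_iff U F]
  simp only [PP, Finset.mem_filter, Finset.mem_univ, true_and, Finset.subset_iff, Finset.mem_union,
    mem_symmDiff_supp, mem_circ, Finset.mem_inter, mem_supp]
  constructor
  · rintro ⟨⟨h1, h2⟩, h3⟩ a
    exact ⟨h1 (x := a), fun e => (h2 e).imp id fun e => ⟨e.1.1, e.1.2, e.2⟩, h3 a⟩
  · intro H
    exact ⟨⟨fun a => (H a).lower, fun a e => ((H a).upper e).imp id
      fun e => ⟨⟨e.1, e.2.1⟩, e.2.2⟩⟩, fun a => (H a).val_ne⟩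

end Support

/-! ### The elements `B` and `D` as Kronecker products -/

section Expansion

variable (F : Type w) [Field F]

/-- The Kronecker factor of `B_{g,h,i}` at one coordinate. -/
def factorB {V : Type u} [Fintype V] [DecidableEq V] [Nontrivial V] (x : V) (g h i : Fin 2) :
    Matrix V V F :=
  Matrix.of fun y z => if ((AssocScheme.trivial V).rel x y = g ∧
    (AssocScheme.trivial V).rel x z = i) ∧ (g ≠ i → (AssocScheme.trivial V).rel y z = 1) ∧
      ((AssocScheme.trivial V).rel y z = 1 → h = 1) then 1 else 0

section

variable {V : Type u} [Fintype V] [DecidableEq V] [Nontrivial V] (x : V)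

theorem factorB_eq_block {g h i : Fin 2} (h1 : g ≠ i → h = 1) (h2 : g = 1 → i = 1 → h = 1) :
    factorB F x g h i = block F (AssocScheme.trivial V) x g i := by
  ext y z
  rw [factorB, Matrix.of_apply, block_apply]
  refine if_congr (and_iff_left_of_imp ?_) rfl rfl
  simp only [trivial_rel]
  rintro ⟨rfl, rfl⟩
  by_cases hy : x = y <;> by_cases hz : x = z <;> grind

theorem factorB_one_zero_one : factorB F x 1 0 1 = (AssocScheme.trivial V).dualIdem F x 1 := by
  ext y z
  simp only [factorB, Matrix.of_apply, AssocScheme.dualIdem, Matrix.diagonal_apply, trivial_rel]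
  split_ifs <;> simp_all

open Classical in
/-- The factor of `D_{g,h,i}` is the corresponding combination of the factors of `B_{g,l,i}`. -/
theorem sum_factorB {g h i : Fin 2} (H : Adm F V g h i) (y z : V) :
    ∑ l ∈ Finset.univ.filter (fun l : Fin 2 => (h = 1 → l = 1) ∧
        (l = 1 → g ≠ i ∨ (g = 1 ∧ i = 1 ∧ 2 < Fintype.card V)) ∧
        ((AssocScheme.trivial V).valency l : F) ≠ 0),
      ((if l = 1 ∧ h ≠ 1 then -1 else 1) *
        ((AssocScheme.trivial V).valency (if i = 1 ∧ l = 1 then 1 else 0) : F)⁻¹) *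
        factorB F x g l i y z = factor F V x g h i y z := by
  obtain ⟨h1, h2, h3⟩ := H
  rw [Finset.sum_filter, Fin.sum_univ_two]
  have b11 := factorB_eq_block F x (g := 1) (h := 1) (i := 1) (by simp) (by simp)
  rcases fin_two_eq g with rfl | rfl <;> rcases fin_two_eq i with rfl | rfl <;>
    rcases fin_two_eq h with rfl | rfl
  · simp [factor, IsExc, factorB_eq_block]
  · simp at h2
  · simp at h1
  · simp [factor, IsExc, factorB_eq_block, h3]
  · simp at h1
  · simp [factor, IsExc, factorB_eq_block, h3]
  · by_cases hc : 2 < Fintype.card V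
    -- If `k_1 = 0` in `F`, the summand at `l = 1` is absent from the sum, and it is absent from
    -- `factor` because `0⁻¹ = 0`.
    · by_cases hk : ((AssocScheme.trivial V).valency 1 : F) = 0
      · simp [factor, IsExc, factorB_one_zero_one, hc, hk]
      · simp [factor, IsExc, factorB_one_zero_one, b11, hc, hk, sub_eq_add_neg]
    · simp [factor, IsExc, factorB_one_zero_one, hc, dual_trivial_one F x hc,
        valency_one_of_card_le V hc]
  · simp at h2
    simp [factor, IsExc, b11, h2, h3]

end

variable {n : ℕ} (U : Fin n → Type u) [∀ a, Fintype (U a)]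
  [∀ a, DecidableEq (U a)] [∀ a, Nontrivial (U a)] (x : ∀ a, U a)

theorem coe_B (g h i : Tup n) :
    (B F U x g h i : Matrix (∀ a, U a) (∀ a, U a) F) =
      tensor fun a => factorB F (x a) (g a) (h a) (i a) := by
  ext y z
  have hsub : ∀ j : Tup n, symmDiff (supp g) (supp i) ⊆ supp j ∧ supp j ⊆ supp h ↔
      ∀ a, (g a ≠ i a → j a = 1) ∧ (j a = 1 → h a = 1) := by
    intro j
    simp only [Finset.subset_iff, mem_symmDiff_supp, mem_supp, forall_and]
  have hterm : ∀ j : Tup n, ((scheme U).dualIdem F x g * (scheme U).adj F j *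
      (scheme U).dualIdem F x i) y z = if j = (scheme U).rel y z then
        if (scheme U).rel x y = g ∧ (scheme U).rel x z = i then 1 else 0 else 0 := by
    intro j
    simp only [AssocScheme.dualIdem, AssocScheme.adj, Matrix.diagonal_mul, Matrix.mul_diagonal,
      Matrix.of_apply]
    split_ifs <;> simp_all
  simp only [B, AssocScheme.adjT, AssocScheme.dualT, AddSubmonoidClass.coe_finsetSum,
    MulMemClass.coe_mul, Matrix.sum_apply, hterm, hsub]
  rw [Finset.sum_ite_eq']
  simp only [Finset.mem_filter, Finset.mem_univ, true_and, tensor_apply, factorB, Matrix.of_apply,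
    Finset.prod_ite_zero, Finset.prod_const_one, forall_and]
  rw [← ite_and]
  congr 1
  simp only [funext_iff, scheme, AssocScheme.pi, eq_iff_iff, true_implies]
  tauto

variable (p : ℕ) [CharP F p]

theorem coe_D {g h i : Tup n} (H : ∀ a, Adm F (U a) (g a) (h a) (i a)) :
    (D F U x p g h i : Matrix (∀ a, U a) (∀ a, U a) F) =
      tensor fun a => factor F (U a) (x a) (g a) (h a) (i a) := by
  classical
  ext y z
  have hfilter : (Finset.univ.filter fun l : Tup n =>
      supp h ⊆ supp l ∧ supp l ⊆ supp (prodTup U g i) ∧ ¬ p ∣ val U l) =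
      Fintype.piFinset fun a => Finset.univ.filter (fun l : Fin 2 => (h a = 1 → l = 1) ∧
        (l = 1 → g a ≠ i a ∨ (g a = 1 ∧ i a = 1 ∧ 2 < Fintype.card (U a))) ∧
        ((AssocScheme.trivial (U a)).valency l : F) ≠ 0) := by
    ext l
    simp only [not_dvd_val_iff U F, Finset.mem_filter, Finset.mem_univ, true_and,
      Fintype.mem_piFinset, Finset.subset_iff, prodTup_apply_eq_one, mem_supp, forall_and]
  have hcoef : ∀ l : Tup n, (-1 : F) ^ (supp l \ supp h).card *
      ((val U (ofSupp (supp i ∩ supp l)) : ℕ) : F)⁻¹ =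
      ∏ a, ((if l a = 1 ∧ h a ≠ 1 then -1 else 1) *
        ((AssocScheme.trivial (U a)).valency (if i a = 1 ∧ l a = 1 then 1 else 0) : F)⁻¹) := by
    intro l
    rw [Finset.prod_mul_distrib, val_eq_prod, Nat.cast_prod, ← Finset.prod_inv_distrib]
    congr 1
    · rw [← Finset.prod_filter, Finset.prod_const]
      congr 2
      ext a
      simp [mem_supp]
    · simp only [ofSupp, Finset.mem_inter, mem_supp]
  simp only [D, AddSubmonoidClass.coe_finsetSum, SetLike.val_smul, coe_B, hfilter, hcoef,
    Matrix.sum_apply, Matrix.smul_apply, smul_eq_mul, tensor_apply, ← Finset.prod_mul_distrib]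
  rw [← Finset.prod_univ_sum (fun a => Finset.univ.filter (fun l : Fin 2 => (h a = 1 → l = 1) ∧
        (l = 1 → g a ≠ i a ∨ (g a = 1 ∧ i a = 1 ∧ 2 < Fintype.card (U a))) ∧
        ((AssocScheme.trivial (U a)).valency l : F) ≠ 0))
    (fun a l => ((if l = 1 ∧ h a ≠ 1 then -1 else 1) *
        ((AssocScheme.trivial (U a)).valency (if i a = 1 ∧ l = 1 then 1 else 0) : F)⁻¹) *
        factorB F (x a) (g a) l (i a) (y a) (z a))]
  exact Finset.prod_congr rfl fun a _ => sum_factorB F (x a) (H a) (y a) (z a)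

theorem D_ne_zero {g h i : Tup n} (H : ∀ a, Adm F (U a) (g a) (h a) (i a)) :
    D F U x p g h i ≠ 0 := by
  intro h0
  refine tensor_ne_zero (fun a => factor_ne_zero (x a) (H a)) ?_
  rw [← coe_D F U x p H, h0]
  rfl

/-- The `D_{g,h,i}` multiply in `T` itself, not only modulo the radical, with structure constants
`0` and `1`. -/
theorem D_mul_D {g h i j k l : Tup n} (H : ∀ a, Adm F (U a) (g a) (h a) (i a))
    (K : ∀ a, Adm F (U a) (j a) (k a) (l a)) :
    D F U x p g h i * D F U x p j k l =
      if i = j ∧ circ U (supp g ∩ supp i) \ supp h = circ U (supp i ∩ supp l) \ supp k then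
        D F U x p g (bracket U g h i k l) l else 0 := by
  refine Subtype.ext ?_
  rw [MulMemClass.coe_mul, coe_D F U x p H, coe_D F U x p K, tensor_mul]
  simp only [factor_mul_factor _ (H _) (K _)]
  split_ifs with hc
  · obtain ⟨rfl, hc⟩ := hc
    rw [circ_sdiff_eq_iff] at hc
    have : ∀ a, Adm F (U a) (g a) (bracket U g h i k l a) (l a) := fun a => by
      rw [bracket_apply]
      exact (H a).bracketCoord (K a)
    rw [coe_D F U x p this]
    congr 1
    ext1 a
    rw [if_pos ⟨rfl, hc a⟩, bracket_apply]
  · obtain ⟨a, ha⟩ : ∃ a, ¬ (i a = j a ∧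
        (IsExc (U a) (g a) (h a) (i a) ↔ IsExc (U a) (j a) (k a) (l a))) := by
      by_contra! hall
      obtain rfl : i = j := funext fun a => (hall a).1
      exact hc ⟨rfl, (circ_sdiff_eq_iff U).2 fun a => (hall a).2⟩
    exact tensor_eq_zero a (if_neg ha)

/-- Flanking `D_{j,k,l}` by `D_{i,h,g}` is zero except at `(j, k, l) = (g, h, i)`; in that case
`D_{i,h,g}` is recovered. -/
theorem D_mul_D_mul_D {g h i j k l : Tup n} (H : ∀ a, Adm F (U a) (g a) (h a) (i a))
    (K : ∀ a, Adm F (U a) (j a) (k a) (l a)) :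
    D F U x p i h g * D F U x p j k l * D F U x p i h g =
      if j = g ∧ k = h ∧ l = i then D F U x p i h g else 0 := by
  refine Subtype.ext ?_
  rw [MulMemClass.coe_mul, MulMemClass.coe_mul, coe_D F U x p fun a => (H a).symm,
    coe_D F U x p K, tensor_mul, tensor_mul]
  simp only [factor_mul_factor_mul_factor _ (H _) (K _)]
  split_ifs with hc
  · obtain ⟨rfl, rfl, rfl⟩ := hc
    simp [coe_D F U x p fun a => (H a).symm]
  · obtain ⟨a, ha⟩ : ∃ a, ¬ (j a = g a ∧ k a = h a ∧ l a = i a) := by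
      by_contra! hall
      exact hc ⟨funext fun a => (hall a).1, funext fun a => (hall a).2.1,
        funext fun a => (hall a).2.2⟩
    exact tensor_eq_zero a (if_neg ha)

end Expansion

/-! ### Membership in the Jacobson radical -/

section Jacobson

variable {R : Type*} [Ring R]

theorem mem_jacobson_of_isNilpotent {u : R} (h : ∀ t, IsNilpotent (t * u)) :
    u ∈ Ring.jacobson R := by
  rw [← Ideal.jacobson_bot, Ideal.mem_jacobson_iff]
  intro y
  obtain ⟨z, hz⟩ := (h y).isUnit_add_one.exists_left_inv
  refine ⟨z, (Submodule.mem_bot R).2 ?_⟩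
  rw [mul_assoc, ← mul_add_one, hz, sub_self]

/-- The Jacobson radical contains no nonzero von Neumann regular element, since it contains no
nonzero idempotent. -/
theorem eq_zero_of_mem_jacobson {u v : R} (huv : u * v * u = u) (hu : u ∈ Ring.jacobson R) :
    u = 0 := by
  rw [← Ideal.jacobson_bot, Ideal.mem_jacobson_iff] at hu
  obtain ⟨z, hz⟩ := hu (-v)
  have hz1 : z * (1 - v * u) = 1 := by
    rw [← sub_eq_zero, ← (Submodule.mem_bot R).1 hz]
    noncomm_ring
  have hvu : v * u = 0 := by
    calc v * u = z * (1 - v * u) * (v * u) := by rw [hz1, one_mul]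
      _ = z * (v * u - v * (u * v * u)) := by noncomm_ring
      _ = 0 := by rw [huv, sub_self, mul_zero]
  rw [← huv, mul_assoc, hvu, mul_zero]

end Jacobson

/-! ### The Terwilliger algebra of a trivial scheme -/

section Local

variable (F : Type w) [Field F] {V : Type u} [Fintype V] [DecidableEq V] [Nontrivial V] (x : V)

/-- The matrices `E_g^*` and `E_g^* J E_i^*`, which span the Terwilliger algebra of a trivial
scheme. -/
def spanningSet : Set (Matrix V V F) :=
  Set.range ((AssocScheme.trivial V).dualIdem F x) ∪
    {M | ∃ g i, M = block F (AssocScheme.trivial V) x g i}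

/-- The blocks that lie in the radical: all but `E_0^* J E_0^*` when `k_1` vanishes in `F`, and
none otherwise. -/
def radicalSet : Set (Matrix V V F) :=
  {M | ((AssocScheme.trivial V).valency 1 : F) = 0 ∧
    ∃ g i, (g = 1 ∨ i = 1) ∧ M = block F (AssocScheme.trivial V) x g i}

/-- The Kronecker factors at one coordinate of the elements `D_{g,h,i}`. -/
def factorSet : Set (Matrix V V F) :=
  {M | ∃ g h i, Adm F V g h i ∧ M = factor F V x g h i}

theorem dual_mem (g : Fin 2) : (AssocScheme.trivial V).dualIdem F x g ∈
    (AssocScheme.trivial V).terwilliger F x :=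
  Algebra.subset_adjoin (Or.inr ⟨g, rfl⟩)

theorem adj_mem (g : Fin 2) : (AssocScheme.trivial V).adj F g ∈
    (AssocScheme.trivial V).terwilliger F x :=
  Algebra.subset_adjoin (Or.inl ⟨g, rfl⟩)

theorem adj_trivial_zero : (AssocScheme.trivial V).adj F 0 = 1 := by
  ext y z
  simp only [AssocScheme.adj, Matrix.of_apply, Matrix.one_apply, trivial_rel]
  split_ifs <;> simp_all

theorem adj_zero_add_adj_one (y z : V) :
    ((AssocScheme.trivial V).adj F 0 + (AssocScheme.trivial V).adj F 1) y z = 1 := by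
  simp only [AssocScheme.adj, Matrix.add_apply, Matrix.of_apply, trivial_rel]
  split_ifs <;> simp_all

theorem dual_zero_add_dual_one :
    (AssocScheme.trivial V).dualIdem F x 0 + (AssocScheme.trivial V).dualIdem F x 1 = 1 := by
  ext y z
  simp only [AssocScheme.dualIdem, Matrix.add_apply, Matrix.diagonal_apply, Matrix.one_apply,
    trivial_rel]
  split_ifs <;> simp_all

theorem block_eq (g i : Fin 2) : block F (AssocScheme.trivial V) x g i =
    (AssocScheme.trivial V).dualIdem F x g *
      ((AssocScheme.trivial V).adj F 0 + (AssocScheme.trivial V).adj F 1) *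
      (AssocScheme.trivial V).dualIdem F x i := by
  ext y z
  rw [AssocScheme.dualIdem, AssocScheme.dualIdem, Matrix.mul_diagonal, Matrix.diagonal_mul,
    adj_zero_add_adj_one, mul_one, block, Matrix.vecMulVec_apply]
  rfl

theorem block_mem (g i : Fin 2) : block F (AssocScheme.trivial V) x g i ∈
    (AssocScheme.trivial V).terwilliger F x := by
  rw [block_eq]
  exact mul_mem (mul_mem (dual_mem F x g) (add_mem (adj_mem F x 0) (adj_mem F x 1)))
    (dual_mem F x i)

theorem factor_mem (g h i : Fin 2) : factor F V x g h i ∈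
    (AssocScheme.trivial V).terwilliger F x := by
  rw [factor]
  split_ifs
  · exact sub_mem (dual_mem F x 1) (Subalgebra.smul_mem _ (block_mem F x 1 1) _)
  · exact Subalgebra.smul_mem _ (block_mem F x g i) _

theorem radicalSet_subset :
    radicalSet F x ⊆ ((AssocScheme.trivial V).terwilliger F x : Set (Matrix V V F)) := by
  rintro M ⟨-, g, i, -, rfl⟩
  exact block_mem F x g i

theorem mul_mem_span_spanningSet {M N : Matrix V V F}
    (hM : M ∈ Submodule.span F (spanningSet F x)) (hN : N ∈ Submodule.span F (spanningSet F x)) :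
    M * N ∈ Submodule.span F (spanningSet F x) := by
  have hmul := Submodule.mul_mem_mul hM hN
  rw [Submodule.span_mul_span] at hmul
  refine Submodule.span_le.2 ?_ hmul
  have hd : ∀ g, (AssocScheme.trivial V).dualIdem F x g ∈ Submodule.span F (spanningSet F x) :=
    fun g => Submodule.subset_span (Or.inl ⟨g, rfl⟩)
  have hb : ∀ g i, block F (AssocScheme.trivial V) x g i ∈ Submodule.span F (spanningSet F x) :=
    fun g i => Submodule.subset_span (Or.inr ⟨g, i, rfl⟩)
  rintro _ ⟨_, ⟨g, rfl⟩ | ⟨g, i, rfl⟩, _, ⟨j, rfl⟩ | ⟨j, l, rfl⟩, rfl⟩ <;>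
    simp only [dual_mul_dual, dual_mul_block, block_mul_dual, block_mul_block, SetLike.mem_coe] <;>
    split_ifs <;>
    first
      | exact zero_mem _
      | exact hd _
      | exact hb _ _
      | exact Submodule.smul_mem _ _ (hb _ _)

theorem mem_span_spanningSet {M : Matrix V V F}
    (hM : M ∈ (AssocScheme.trivial V).terwilliger F x) :
    M ∈ Submodule.span F (spanningSet F x) := by
  have hd : ∀ g, (AssocScheme.trivial V).dualIdem F x g ∈ Submodule.span F (spanningSet F x) :=
    fun g => Submodule.subset_span (Or.inl ⟨g, rfl⟩)
  have hb : ∀ g i, block F (AssocScheme.trivial V) x g i ∈ Submodule.span F (spanningSet F x) :=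
    fun g i => Submodule.subset_span (Or.inr ⟨g, i, rfl⟩)
  have h1 : (1 : Matrix V V F) ∈ Submodule.span F (spanningSet F x) := by
    rw [← dual_zero_add_dual_one F x]
    exact add_mem (hd 0) (hd 1)
  have hadj : (AssocScheme.trivial V).adj F 1 = (block F (AssocScheme.trivial V) x 0 0 +
      block F (AssocScheme.trivial V) x 0 1 + block F (AssocScheme.trivial V) x 1 0 +
      block F (AssocScheme.trivial V) x 1 1) - 1 := by
    have h := dual_zero_add_dual_one F x
    calc (AssocScheme.trivial V).adj F 1 = 1 * ((AssocScheme.trivial V).adj F 0 +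
          (AssocScheme.trivial V).adj F 1) * 1 - 1 := by
            rw [adj_trivial_zero]; noncomm_ring
      _ = _ := by
        simp only [block_eq]
        rw [← h]
        noncomm_ring
  induction hM using Algebra.adjoin_induction with
  | mem M hM =>
    rcases hM with ⟨g, rfl⟩ | ⟨g, rfl⟩
    · rcases fin_two_eq g with rfl | rfl
      · rwa [adj_trivial_zero]
      · rw [hadj]
        exact sub_mem (add_mem (add_mem (add_mem (hb _ _) (hb _ _)) (hb _ _)) (hb _ _)) h1
    · exact hd g
  | algebraMap c =>
    rw [Algebra.algebraMap_eq_smul_one]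
    exact Submodule.smul_mem _ _ h1
  | add M N _ _ hM hN => exact add_mem hM hN
  | mul M N _ _ hM hN => exact mul_mem_span_spanningSet F x hM hN

theorem mem_span_factorSet_union_radicalSet {M : Matrix V V F}
    (hM : M ∈ (AssocScheme.trivial V).terwilliger F x) :
    M ∈ Submodule.span F (factorSet F x ∪ radicalSet F x) := by
  refine Submodule.span_le.2 ?_ (mem_span_spanningSet F x hM)
  have hf : ∀ {g h i}, Adm F V g h i →
      factor F V x g h i ∈ Submodule.span F (factorSet F x ∪ radicalSet F x) :=
    fun H => Submodule.subset_span (Or.inl ⟨_, _, _, H, rfl⟩)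
  have hb : ∀ g i, block F (AssocScheme.trivial V) x g i ∈
      Submodule.span F (factorSet F x ∪ radicalSet F x) := by
    intro g i
    by_cases h0 : g = 0 ∧ i = 0
    · obtain ⟨rfl, rfl⟩ := h0
      simpa [factor, IsExc] using hf (g := 0) (h := 0) (i := 0) ⟨by simp, by simp, by simp⟩
    have hgi : g = 1 ∨ i = 1 := by
      rcases fin_two_eq g with rfl | rfl <;> rcases fin_two_eq i with rfl | rfl <;> simp_all
    by_cases hk : ((AssocScheme.trivial V).valency 1 : F) = 0
    · exact Submodule.subset_span (Or.inr ⟨hk, g, i, hgi, rfl⟩)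
    obtain ⟨h, H, e⟩ : ∃ h, Adm F V g h i ∧ ¬ IsExc V g h i := by
      by_cases hc : g = i ∧ ¬ 2 < Fintype.card V
      · exact ⟨0, ⟨fun e => absurd hc.1 e, by simp, by simp⟩, fun e => hc.2 e.1.2.2⟩
      · refine ⟨1, ⟨fun _ => rfl, fun _ => ?_, hk⟩, by simp [IsExc]⟩
        rcases fin_two_eq g with rfl | rfl <;> rcases fin_two_eq i with rfl | rfl <;> simp_all
    have hfac := Submodule.smul_mem _ ((AssocScheme.trivial V).valency i : F) (hf H)
    rwa [factor, if_neg e, smul_smul, mul_inv_cancel₀ (H.valency_ne_zero e).2, one_smul] at hfac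
  rintro _ (⟨g, rfl⟩ | ⟨g, i, rfl⟩)
  · rcases fin_two_eq g with rfl | rfl
    · rw [dual_trivial_zero]
      exact hb 0 0
    · by_cases hc : 2 < Fintype.card V
      · have hfac := add_mem (hf (g := 1) (h := 0) (i := 1) ⟨by simp, by simp, by simp⟩)
          (Submodule.smul_mem _ ((AssocScheme.trivial V).valency 1 : F)⁻¹ (hb 1 1))
        rwa [factor, if_pos ⟨⟨rfl, rfl, hc⟩, rfl⟩, sub_add_cancel] at hfac
      · rw [dual_trivial_one F x hc]
        exact hb 1 1
  · exact hb g i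

theorem mul_mem_span_radicalSet {M N : Matrix V V F}
    (hM : M ∈ (AssocScheme.trivial V).terwilliger F x) (hN : N ∈ radicalSet F x) :
    M * N ∈ Submodule.span F (radicalSet F x) := by
  have hmul := Submodule.mul_mem_mul (mem_span_spanningSet F x hM)
    (Submodule.mem_span_singleton_self N)
  rw [Submodule.span_mul_span] at hmul
  refine Submodule.span_le.2 ?_ hmul
  obtain ⟨hk, j, l, hjl, rfl⟩ := hN
  have hb : ∀ g i, g = 1 ∨ i = 1 → block F (AssocScheme.trivial V) x g i ∈
      Submodule.span F (radicalSet F x) :=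
    fun g i hgi => Submodule.subset_span ⟨hk, g, i, hgi, rfl⟩
  rintro _ ⟨_, ⟨g, rfl⟩ | ⟨g, i, rfl⟩, _, rfl, rfl⟩ <;>
    simp only [dual_mul_block, block_mul_block, SetLike.mem_coe] <;> split_ifs with h
  · exact hb _ _ hjl
  · exact zero_mem _
  · subst h
    rcases fin_two_eq i with rfl | rfl
    · exact Submodule.smul_mem _ _ (hb _ _ (Or.inr (by simpa using hjl)))
    · rw [hk, zero_smul]
      exact zero_mem _
  · exact zero_mem _

/-- A nonzero product of three blocks has `E_0^* J E_0^*` in the middle when `k_1` vanishes. -/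
theorem radicalSet_mul_mul {M N P : Matrix V V F} (hM : M ∈ Submodule.span F (radicalSet F x))
    (hN : N ∈ Submodule.span F (radicalSet F x)) (hP : P ∈ Submodule.span F (radicalSet F x)) :
    M * N * P = 0 := by
  have hmul := Submodule.mul_mem_mul (Submodule.mul_mem_mul hM hN) hP
  rw [Submodule.span_mul_span, Submodule.span_mul_span] at hmul
  rw [← Submodule.mem_bot F]
  refine Submodule.span_le.2 ?_ hmul
  rintro _ ⟨_, ⟨_, ⟨hk, g, i, -, rfl⟩, _, ⟨-, j, l, hjl, rfl⟩, rfl⟩, _, ⟨-, q, r, -, rfl⟩, rfl⟩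
  simp only [block_mul_block, SetLike.mem_coe, Submodule.mem_bot]
  split_ifs with h
  · subst h
    rcases hjl with rfl | rfl
    · simp [hk]
    · simp [block_mul_block, hk]
  · simp

end Local

/-! ### Spanning modulo the radical -/

section Span

variable (F : Type w) [Field F] {n : ℕ} (U : Fin n → Type u) [∀ a, Fintype (U a)]
  [∀ a, DecidableEq (U a)] [∀ a, Nontrivial (U a)] (x : ∀ a, U a)

theorem adj_eq_tensor (g : Tup n) :
    (scheme U).adj F g = tensor fun a => (AssocScheme.trivial (U a)).adj F (g a) := by
  ext y z
  simp only [AssocScheme.adj, tensor_apply, Matrix.of_apply, Finset.prod_ite_zero,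
    Finset.prod_const_one, Finset.mem_univ, true_implies]
  refine if_congr ?_ rfl rfl
  exact funext_iff

theorem dual_eq_tensor (g : Tup n) : (scheme U).dualIdem F x g =
    tensor fun a => (AssocScheme.trivial (U a)).dualIdem F (x a) (g a) := by
  ext y z
  simp only [AssocScheme.dualIdem, tensor_apply, Matrix.diagonal_apply, Finset.prod_ite_zero,
    Finset.prod_const_one, Finset.mem_univ, true_implies]
  refine if_congr funext_iff ?_ rfl
  refine if_congr ?_ rfl rfl
  exact funext_iff

/-- Every element of `T` is a combination of Kronecker products of elements of the Terwilliger
algebras of the factors. -/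
theorem mem_span_tensor {t : Matrix (∀ a, U a) (∀ a, U a) F}
    (ht : t ∈ (scheme U).terwilliger F x) :
    t ∈ Submodule.span F {t | ∃ M : ∀ a, Matrix (U a) (U a) F,
      (∀ a, M a ∈ (AssocScheme.trivial (U a)).terwilliger F (x a)) ∧ t = tensor M} := by
  rw [AssocScheme.terwilliger, ← Subalgebra.mem_toSubmodule, Algebra.adjoin_eq_span] at ht
  refine Submodule.span_mono ?_ ht
  intro t ht
  induction ht using Submonoid.closure_induction with
  | mem t ht =>
    rcases ht with ⟨g, rfl⟩ | ⟨g, rfl⟩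
    · exact ⟨_, fun a => adj_mem F (x a) (g a), adj_eq_tensor F U g⟩
    · exact ⟨_, fun a => dual_mem F (x a) (g a), dual_eq_tensor F U x g⟩
  | one => exact ⟨_, fun a => one_mem _, tensor_one.symm⟩
  | mul s t _ _ hs ht =>
    obtain ⟨M, hM, rfl⟩ := hs
    obtain ⟨N, hN, rfl⟩ := ht
    exact ⟨_, fun a => mul_mem (hM a) (hN a), tensor_mul M N⟩

/-- Every element of the Terwilliger algebra of one factor extends to `T` by identity matrices. -/
theorem tensor_update_one_mem (a : Fin n) {M : Matrix (U a) (U a) F}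
    (hM : M ∈ (AssocScheme.trivial (U a)).terwilliger F (x a)) :
    tensor (Function.update (fun b => (1 : Matrix (U b) (U b) F)) a M) ∈
      (scheme U).terwilliger F x := by
  induction hM using Algebra.adjoin_induction with
  | mem M hM =>
    rcases hM with ⟨g, rfl⟩ | ⟨g, rfl⟩
    · refine Algebra.subset_adjoin (Or.inl ⟨Function.update 0 a g, ?_⟩)
      rw [adj_eq_tensor]
      congr 1
      ext1 b
      rcases eq_or_ne b a with rfl | hb
      · simp
      · simp [hb, adj_trivial_zero]
    · have : tensor (Function.update (fun b => (1 : Matrix (U b) (U b) F)) a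
          ((AssocScheme.trivial (U a)).dualIdem F (x a) g)) =
          ∑ h ∈ Finset.univ.filter (fun h : Tup n => h a = g), (scheme U).dualIdem F x h := by
        ext y z
        rw [Matrix.sum_apply]
        simp only [AssocScheme.dualIdem, Matrix.diagonal_apply]
        by_cases hyz : y = z
        · subst hyz
          simp only [if_true]
          rw [Finset.sum_ite_eq, tensor_apply, Finset.prod_eq_single a]
          · simp only [Function.update_self, Matrix.diagonal_apply_eq, Finset.mem_filter,
              Finset.mem_univ, true_and]
            rfl
          · intro b _ hb
            simp [hb]
          · simp
        · simp only [if_neg hyz, Finset.sum_const_zero]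
          obtain ⟨b, hb⟩ := Function.ne_iff.1 hyz
          refine Finset.prod_eq_zero (Finset.mem_univ b) ?_
          rcases eq_or_ne b a with rfl | hba
          · simp [hb]
          · simp [hba, hb]
      rw [this]
      exact sum_mem fun h _ => Algebra.subset_adjoin (Or.inr ⟨h, rfl⟩)
  | algebraMap c =>
    rw [Algebra.algebraMap_eq_smul_one, MultilinearMap.map_update_smul, Function.update_eq_self,
      tensor_one]
    exact Subalgebra.smul_mem _ (one_mem _) c
  | add M N _ _ hM hN =>
    rw [MultilinearMap.map_update_add]
    exact add_mem hM hN
  | mul M N _ _ hM hN =>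
    have := mul_mem hM hN
    rw [tensor_mul] at this
    convert this using 2
    ext1 b
    rcases eq_or_ne b a with rfl | hb
    · simp
    · simp [hb]

theorem tensor_mem {M : ∀ a, Matrix (U a) (U a) F}
    (hM : ∀ a, M a ∈ (AssocScheme.trivial (U a)).terwilliger F (x a)) :
    tensor M ∈ (scheme U).terwilliger F x := by
  have key : ∀ s : Finset (Fin n),
      tensor (fun a => if a ∈ s then M a else 1) ∈ (scheme U).terwilliger F x := by
    intro s
    induction s using Finset.induction_on with
    | empty => simp [tensor_one]
    | insert a s ha ih =>
      have := mul_mem ih (tensor_update_one_mem F U x a (hM a))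
      rw [tensor_mul] at this
      convert this using 2
      ext1 b
      rcases eq_or_ne b a with rfl | hb
      · simp [ha]
      · simp [hb]
  simpa using key Finset.univ

/-- A Kronecker product one of whose factors is nilpotent of the kind in `radicalSet` lies in the
radical, since every left multiple of it has vanishing cube. -/
theorem tensor_mem_radical {M : ∀ a, Matrix (U a) (U a) F}
    (hM : ∀ a, M a ∈ (AssocScheme.trivial (U a)).terwilliger F (x a))
    {a : Fin n} (ha : M a ∈ radicalSet F (x a)) :
    (⟨tensor M, tensor_mem F U x hM⟩ : T F U x) ∈ RadT F U x := by
  refine mem_jacobson_of_isNilpotent fun t => ⟨3, Subtype.ext ?_⟩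
  set N : Set (Matrix (∀ a, U a) (∀ a, U a) F) := {t | ∃ M : ∀ a, Matrix (U a) (U a) F,
    M a ∈ Submodule.span F (radicalSet F (x a)) ∧ t = tensor M}
  have hw : (t : Matrix (∀ a, U a) (∀ a, U a) F) * tensor M ∈ Submodule.span F N := by
    have hmul := Submodule.mul_mem_mul (mem_span_tensor F U x t.2)
      (Submodule.mem_span_singleton_self (tensor M))
    rw [Submodule.span_mul_span] at hmul
    refine Submodule.span_mono ?_ hmul
    rintro _ ⟨_, ⟨P, hP, rfl⟩, _, rfl, rfl⟩
    exact ⟨_, mul_mem_span_radicalSet F (x a) (hP a) ha, tensor_mul P M⟩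
  have hcube := Submodule.mul_mem_mul (Submodule.mul_mem_mul hw hw) hw
  rw [Submodule.span_mul_span, Submodule.span_mul_span] at hcube
  have h0 : (t : Matrix (∀ a, U a) (∀ a, U a) F) * tensor M * (t * tensor M) * (t * tensor M)
      = 0 := by
    refine (Submodule.mem_bot F).1 (Submodule.span_le.2 ?_ hcube)
    rintro _ ⟨_, ⟨_, ⟨P, hP, rfl⟩, _, ⟨Q, hQ, rfl⟩, rfl⟩, _, ⟨R, hR, rfl⟩, rfl⟩
    simp only [tensor_mul, SetLike.mem_coe, Submodule.mem_bot]
    exact tensor_eq_zero a (radicalSet_mul_mul F (x a) hP hQ hR)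
  rw [pow_succ, pow_two]
  exact h0

variable (p : ℕ) [CharP F p]

/-- The factors are expanded one coordinate at a time: `s` is the set of the coordinates that remain
to be expanded. -/
theorem tensor_mem_span_D_sup_radical (s : Finset (Fin n)) :
    ∀ {M : ∀ a, Matrix (U a) (U a) F},
      (∀ a ∈ s, M a ∈ (AssocScheme.trivial (U a)).terwilliger F (x a)) →
      (∀ a ∉ s, M a ∈ factorSet F (x a)) →
      tensor M ∈ Submodule.map ((scheme U).terwilliger F x).val.toLinearMap
        (Submodule.span F (Set.range fun t : Idx U p => D F U x p t.1.1 t.1.2.1 t.1.2.2) ⊔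
          (RadT F U x).restrictScalars F) := by
  induction s using Finset.induction_on with
  | empty =>
    intro M _ hM
    choose g h i H hM using fun a => hM a (Finset.notMem_empty a)
    refine ⟨D F U x p g h i, Submodule.mem_sup_left (Submodule.subset_span
      ⟨⟨(g, h, i), (mem_PP_and_not_dvd_iff U F p g h i).2 H⟩, rfl⟩), ?_⟩
    rw [funext hM]
    exact coe_D F U x p H
  | insert a s ha ih =>
    intro M hs hns
    have hfac : ∀ b P, P ∈ factorSet F (x b) →
        P ∈ (AssocScheme.trivial (U b)).terwilliger F (x b) := by
      rintro b _ ⟨g, h, i, -, rfl⟩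
      exact factor_mem F (x b) g h i
    rw [← Function.update_eq_self a M]
    have hspan := mem_span_factorSet_union_radicalSet F (x a) (hs a (Finset.mem_insert_self a s))
    generalize M a = P at hspan
    induction hspan using Submodule.span_induction with
    | mem P hP =>
      rcases hP with hP | hP
      · refine ih (fun b hb => ?_) fun b hb => ?_
        · rw [Function.update_of_ne (ne_of_mem_of_not_mem hb ha)]
          exact hs b (Finset.mem_insert_of_mem hb)
        · rcases eq_or_ne b a with rfl | hba
          · rwa [Function.update_self]
          · rw [Function.update_of_ne hba]
            exact hns b (by simp [hb, hba])
      · have hmem : ∀ b, Function.update M a P b ∈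
            (AssocScheme.trivial (U b)).terwilliger F (x b) := by
          intro b
          rcases eq_or_ne b a with rfl | hba
          · rw [Function.update_self]
            exact radicalSet_subset F (x b) hP
          · rw [Function.update_of_ne hba]
            by_cases hb : b ∈ insert a s
            · exact hs b hb
            · exact hfac b _ (hns b hb)
        exact ⟨⟨_, tensor_mem F U x hmem⟩, Submodule.mem_sup_right
          (tensor_mem_radical F U x hmem (a := a) (by rwa [Function.update_self])), rfl⟩
    | zero =>
      rw [MultilinearMap.map_update_zero]
      exact zero_mem _
    | add P Q _ _ hP hQ =>
      rw [MultilinearMap.map_update_add]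
      exact add_mem hP hQ
    | smul c P _ hP =>
      rw [MultilinearMap.map_update_smul]
      exact Submodule.smul_mem _ c hP

theorem mem_span_D_sup_radical (t : T F U x) :
    t ∈ Submodule.span F (Set.range fun t : Idx U p => D F U x p t.1.1 t.1.2.1 t.1.2.2) ⊔
      (RadT F U x).restrictScalars F := by
  have ht := mem_span_tensor F U x t.2
  have hle : Submodule.span F {t | ∃ M : ∀ a, Matrix (U a) (U a) F,
      (∀ a, M a ∈ (AssocScheme.trivial (U a)).terwilliger F (x a)) ∧ t = tensor M} ≤
      Submodule.map ((scheme U).terwilliger F x).val.toLinearMap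
        (Submodule.span F (Set.range fun t : Idx U p => D F U x p t.1.1 t.1.2.1 t.1.2.2) ⊔
          (RadT F U x).restrictScalars F) := by
    refine Submodule.span_le.2 ?_
    rintro _ ⟨M, hM, rfl⟩
    exact tensor_mem_span_D_sup_radical F U x p Finset.univ (fun a _ => hM a) (by simp)
  obtain ⟨t', ht', h⟩ := hle ht
  rwa [← Subtype.ext h]

end Span

/-! ### The basis of the quotient and its structure constants -/

section Basis

variable (F : Type w) [Field F] {n : ℕ} (U : Fin n → Type u) [∀ a, Fintype (U a)]
  [∀ a, DecidableEq (U a)] [∀ a, Nontrivial (U a)] (x : ∀ a, U a) (p : ℕ) [CharP F p]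

theorem linearIndependent_Dbar :
    LinearIndependent F fun t : Idx U p => Dbar F U x p t.1.1 t.1.2.1 t.1.2.2 := by
  rw [linearIndependent_iff']
  intro s c hc t ht
  have hadm : ∀ t : Idx U p, ∀ a, Adm F (U a) (t.1.1 a) (t.1.2.1 a) (t.1.2.2 a) := fun t =>
    (mem_PP_and_not_dvd_iff U F p _ _ _).1 t.2
  have hmem : ∑ r ∈ s, c r • D F U x p r.1.1 r.1.2.1 r.1.2.2 ∈ RadT F U x := by
    rw [← Ideal.Quotient.eq_zero_iff_mem, ← hc, map_sum]
    rfl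
  set u := D F U x p t.1.2.2 t.1.2.1 t.1.1 with hu
  have hflank : u * (∑ r ∈ s, c r • D F U x p r.1.1 r.1.2.1 r.1.2.2) * u = c t • u := by
    rw [Finset.mul_sum, Finset.sum_mul, Finset.sum_eq_single t]
    · rw [mul_smul_comm, smul_mul_assoc, hu, D_mul_D_mul_D F U x p (hadm t) (hadm t),
        if_pos ⟨rfl, rfl, rfl⟩]
    · intro r _ hr
      rw [mul_smul_comm, smul_mul_assoc, hu, D_mul_D_mul_D F U x p (hadm t) (hadm r), if_neg,
        smul_zero]
      rintro ⟨h1, h2, h3⟩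
      exact hr (Subtype.ext (Prod.ext h1 (Prod.ext h2 h3)))
    · exact fun h => absurd ht h
  have hcu : c t • u ∈ RadT F U x := by
    rw [← hflank]
    exact Ideal.mul_mem_right _ _ (Ideal.mul_mem_left _ _ hmem)
  by_contra hct
  have hurad : u ∈ RadT F U x := by
    have := Submodule.smul_of_tower_mem (RadT F U x) (c t)⁻¹ hcu
    rwa [smul_smul, inv_mul_cancel₀ hct, one_smul] at this
  refine D_ne_zero F U x p (fun a => (hadm t a).symm) (eq_zero_of_mem_jacobson
    (v := D F U x p t.1.1 t.1.2.1 t.1.2.2) ?_ hurad)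
  rw [D_mul_D_mul_D F U x p (hadm t) (hadm t), if_pos ⟨rfl, rfl, rfl⟩]

theorem span_Dbar :
    ⊤ ≤ Submodule.span F
      (Set.range fun t : Idx U p => Dbar F U x p t.1.1 t.1.2.1 t.1.2.2) := by
  intro y _
  obtain ⟨t, rfl⟩ := Ideal.Quotient.mk_surjective y
  obtain ⟨d, hd, r, hr, rfl⟩ := Submodule.mem_sup.1 (mem_span_D_sup_radical F U x p t)
  rw [map_add, Ideal.Quotient.eq_zero_iff_mem.2 hr, add_zero]
  have := Submodule.mem_map_of_mem (f := (Ideal.Quotient.mkₐ F (RadT F U x)).toLinearMap) hd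
  rw [Submodule.map_span, ← Set.range_comp] at this
  exact this

/-- The basis of `T / Rad(T)` formed by the cosets of the elements `D_{a,b,c}`. -/
noncomputable def basisDbar : Basis (Idx U p) F (T F U x ⧸ RadT F U x) :=
  Basis.mk (linearIndependent_Dbar F U x p) (span_Dbar F U x p)

theorem basisDbar_apply (t : Idx U p) :
    basisDbar F U x p t = Dbar F U x p t.1.1 t.1.2.1 t.1.2.2 :=
  Basis.mk_apply _ _ t

theorem basisDbar_repr_mul {g h i j k l m q r : Tup n} (H : h ∈ PP U g i ∧ ¬ p ∣ val U h)
    (K : k ∈ PP U j l ∧ ¬ p ∣ val U k) (Q : q ∈ PP U m r ∧ ¬ p ∣ val U q) :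
    (basisDbar F U x p).repr (Dbar F U x p g h i * Dbar F U x p j k l) ⟨(m, q, r), Q⟩ =
      kdelta F i j * kdelta F m g * kdelta F q (bracket U g h i k l) * kdelta F r l *
        kdelta F (circ U (supp g ∩ supp i) \ supp h) (circ U (supp i ∩ supp l) \ supp k) := by
  rw [mem_PP_and_not_dvd_iff U F p] at H K
  rw [Dbar, Dbar, ← map_mul, D_mul_D F U x p H K]
  split_ifs with hc
  · obtain ⟨rfl, hc⟩ := hc
    have B : bracket U g h i k l ∈ PP U g l ∧ ¬ p ∣ val U (bracket U g h i k l) := by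
      rw [mem_PP_and_not_dvd_iff U F p]
      intro a
      rw [bracket_apply]
      exact (H a).bracketCoord (K a)
    have hb : Ideal.Quotient.mk (RadT F U x) (D F U x p g (bracket U g h i k l) l) =
        basisDbar F U x p ⟨(g, bracket U g h i k l, l), B⟩ := by
      rw [basisDbar_apply, Dbar]
    rw [hb, Basis.repr_self, Finsupp.single_apply, kdelta, kdelta, kdelta, kdelta, kdelta,
      if_pos rfl, if_pos hc]
    simp only [Subtype.mk.injEq, Prod.mk.injEq, eq_comm (b := m), eq_comm (b := q),
      eq_comm (b := r)]
    split_ifs <;> simp_all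
  · rw [map_zero, LinearEquiv.map_zero, Finsupp.zero_apply]
    simp only [kdelta]
    split_ifs <;> simp_all

end Basis

end FactorialScheme

theorem theorem7p15 {F : Type w} [Field F] (p : ℕ) [CharP F p] {n : ℕ}
    (U : Fin n → Type u) [∀ a, Fintype (U a)] [∀ a, DecidableEq (U a)] [∀ a, Nontrivial (U a)]
    (x : ∀ a, U a) :
    -- the cosets of the `D_{a,b,c}` form a basis `b` of `T / Rad(T)`
    ∃ b : Basis (Idx U p) F (T F U x ⧸ RadT F U x),
      (∀ t : Idx U p, b t = Dbar F U x p t.1.1 t.1.2.1 t.1.2.2) ∧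
      (∀ (g h i j k l m q r : Tup n) (_ : h ∈ PP U g i) (_ : k ∈ PP U j l) (hq : q ∈ PP U m r)
        (_ : ¬ p ∣ val U h) (_ : ¬ p ∣ val U k) (hpq : ¬ p ∣ val U q),
        (i = j → circ U (supp h ∩ supp i ∩ supp l) ⊆ supp k →
          bracket U g h i k l ∈ PP U g l ∧ ¬ p ∣ val U (bracket U g h i k l)) ∧
        b.repr (Dbar F U x p g h i * Dbar F U x p j k l) ⟨(m, q, r), hq, hpq⟩ =
          kdelta F i j * kdelta F m g * kdelta F q (bracket U g h i k l) * kdelta F r l *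
            kdelta F (circ U (supp g ∩ supp i) \ supp h) (circ U (supp i ∩ supp l) \ supp k)) ∧
      -- all structure constants lie in `{0, 1}`
      ∀ s t u : Idx U p, b.repr (b s * b t) u ∈ ({0, 1} : Set F) := by
  refine ⟨basisDbar F U x p, basisDbar_apply F U x p, ?_, ?_⟩
  · intro g h i j k l m q r hh hk hq ph pk pq
    refine ⟨?_, basisDbar_repr_mul F U x p ⟨hh, ph⟩ ⟨hk, pk⟩ ⟨hq, pq⟩⟩
    rintro rfl -
    rw [mem_PP_and_not_dvd_iff U F p]
    intro a
    rw [bracket_apply]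
    exact ((mem_PP_and_not_dvd_iff U F p g h i).1 ⟨hh, ph⟩ a).bracketCoord
      ((mem_PP_and_not_dvd_iff U F p i k l).1 ⟨hk, pk⟩ a)
  · intro s t u
    rw [basisDbar_apply, basisDbar_apply, basisDbar_repr_mul F U x p s.2 t.2 u.2]
    simp only [kdelta]
    split_ifs <;> simp
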